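/- Let $n,k\ge 0$ and $0\le p\le 1$. Write $\mathbb F_4=\{0,1,\omega,\omega^2\}$ and, for $\mathbf x\in\mathbb F_4^n$, let $E_{\mathbf x}=e_1\otimes\cdots\otimes e_n$ with $e_j=I,\sigma_x,\sigma_z,\sigma_y$ according to $x_j=0,1,\omega,\omega^2$. Let $\mathcal M(\rho)=\sum_{\mathbf x}\left(\frac p3\right)^{\mathrm{wt}(\mathbf x)}(1-p)^{n-\mathrm{wt}(\mathbf x)}E_{\mathbf x}\rho E_{\mathbf x}^\dagger$ be the symmetric depolarizing channel. For a code (linear subspace) $0\ne Q\subseteq\mathbb C^{2^n}$ with orthogonal projector $P$ put $$F(Q)=\sup_{\mathcal R}\ \min_{|\psi\rangle\in Q,\ \|\psi\|=1}\langle\psi|\mathcal R\mathcal M(|\psi\rangle\langle\psi|)|\psi\rangle,$$ the supremum being over all trace-preserving completely positive linear maps $\mathcal R$, and for $0\le j\le n$ $$B_j(Q)=\frac1{\dim Q}\sum_{\mathrm{wt}(\mathbf x)=j}\mathrm{Tr}(E_{\mathbf x}PE_{\mathbf x}P),\qquad B_j^\perp(Q)=\frac1{(\dim Q)^2}\sum_{\mathrm{wt}(\mathbf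 x)=j}\mathrm{Tr}(E_{\mathbf x}P)^2 .$$ The minimum distance $d(Q)$ is the smallest weight of an $\mathbf x$ such that $PE_{\mathbf x}P$ is not a scalar multiple of $P$ (and $0$ if there is no such $\mathbf x$, which happens for $[[n,k]]$ stabilizer codes only when $k=0$). An $[[n,k]]$ stabilizer code is a $2^k$-dimensional subspace $Q$ that is the space of all vectors fixed by all the operators $\varepsilon(\mathbf x)E_{\mathbf x}$, $\mathbf x\in C^\perp$, for some additive code $C\subseteq\mathbb F_4^n$ with $|C|=2^{n+k}$ and $C^\perp\subseteq C$ and some signs $\varepsilon(\mathbf x)\in\{1,-1\}$, where $C^\perp$ is the dual of $C$ with respect to the trace inner product $\mathrm{Tr}^{\mathbb F_4}_{\mathbb F_2}\sum_j x_j\overline{y_j}$. Let $\mathcal Q$ be any nonempty (necessarily finite) set of $[[n,k]]$ stabilizer codes, let $$\bar F=\frac1{|\mathcal Q|}\sum_{Q\in\mathcal Q}F(Q),\qquad \bar B_j=\frac1{|\mathcal Q|}\sum_{Q\in\mathcal Q}B_j(Q),\qquad \bar B_j^\perp=\frac1{|\mathcal Q|}\sum_{Q\in\mathcal Q}B_j^\perp(Q),$$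 and let $d_{\min}=\min_{Q\in\mathcal Q}d(Q)$. Then $$1-\bar F=\frac1{|\mathcal Q|}\sum_{Q\in\mathcal Q}(1-F(Q))\ \le\ \sum_{m=\lceil d_{\min}/2\rceil}^n\left(\frac p3\right)^m(1-p)^{n-m}\min\left\{\binom nm3^m,\ \bar N(m)\right\},$$ where $$\bar N(m)=\sum_{w=d_{\min}}^{\min(2m,n)}(\bar B_w-\bar B_w^\perp)\,G(m,w),$$ $$G(m,w)=\sum_{t=0}^m\binom wt2^t\sum_{h=\lceil (w-t)/2\rceil}^{m-t}\binom{w-t}h\binom{n-w}{m-t-h}3^{m-t-h}$$ (terms with $t>w$ are $0$). -/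

import Mathlib

open scoped ComplexOrder

namespace StabFidelity

noncomputable section

/-! ## The field with four elements and additive codes over it -/

/-- The field `𝔽₄ = {0, 1, ω, ω²}`. -/
abbrev F4 : Type := GaloisField 2 2

instance instFintypeF4 : Fintype F4 := Fintype.ofFinite F4

instance instDecidableEqF4 : DecidableEq F4 := Classical.decEq F4

/-- Vectors of length `n` over `𝔽₄`.  Their Hamming weight is Mathlib's `hammingNorm`. -/
abbrev Word (n : ℕ) : Type := Fin n → F4

/-- The trace inner product `Tr (∑ⱼ xⱼ * conj yⱼ)`; the conjugation of `𝔽₄` (which exchanges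
`ω` and `ω²` and fixes `0` and `1`) is the Frobenius map `y ↦ y ^ 2`. -/
def traceInner {n : ℕ} (x y : Word n) : ZMod 2 :=
  Algebra.trace (ZMod 2) F4 (∑ j, x j * y j ^ 2)

/-- The Hermitian dual `C^⊥` of an additive code `C`, with respect to the trace inner product. -/
def hermDual {n : ℕ} (C : AddSubgroup (Word n)) : AddSubgroup (Word n) where
  carrier := {x | ∀ y ∈ C, traceInner x y = 0}
  zero_mem' := by
    intro y _
    simp [traceInner]
  add_mem' := by
    intro a b ha hb y hy
    have h1 := ha y hy
    have h2 := hb y hy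
    simp only [traceInner, Pi.add_apply, add_mul, Finset.sum_add_distrib, map_add] at *
    rw [h1, h2, add_zero]
  neg_mem' := by
    intro a ha y hy
    have h1 := ha y hy
    simp only [traceInner, Pi.neg_apply, neg_mul, Finset.sum_neg_distrib, map_neg] at *
    rw [h1, neg_zero]

/-! ## Qubits, error operators, channels -/

/-- Labels of the computational basis of the space of `n` qubits. -/
abbrev Basis (n : ℕ) : Type := Fin n → Fin 2

/-- The space `ℂ^(2^n)` of `n` qubits. -/
abbrev Qubits (n : ℕ) : Type := EuclideanSpace ℂ (Basis n)

/-- Operators on `n` qubits, as matrices in the computational basis. -/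
abbrev Op (n : ℕ) : Type := Matrix (Basis n) (Basis n) ℂ

/-- The operator attached to an element of `𝔽₄ = {0, 1, ω, ω²}`:
`0 ↦ I`, `1 ↦ σ_x`, `ω ↦ σ_z`, `ω² ↦ σ_y`. -/
def pauli (ω : F4) (a : F4) : Matrix (Fin 2) (Fin 2) ℂ :=
  if a = 0 then 1
  else if a = 1 then !![0, 1; 1, 0]
  else if a = ω then !![1, 0; 0, -1]
  else !![0, Complex.I; -Complex.I, 0]

/-- The error operator `E_x = e₁ ⊗ ⋯ ⊗ e_n` (entries of a Kronecker product). -/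
def errorOp (ω : F4) {n : ℕ} (x : Word n) : Op n :=
  Matrix.of fun a b => ∏ j, pauli ω (x j) (a j) (b j)

/-- The probability `(p/3)^wt(x) (1-p)^(n-wt(x))` of the error `E_x`. -/
def errorProb (p : ℝ) {n : ℕ} (x : Word n) : ℝ :=
  (p / 3) ^ hammingNorm x * (1 - p) ^ (n - hammingNorm x)

/-- The symmetric depolarizing channel `ρ ↦ ∑ₓ Pr(E_x) E_x ρ E_x†`. -/
def depolarizing (ω : F4) (p : ℝ) {n : ℕ} (ρ : Op n) : Op n :=
  ∑ x : Word n, (errorProb p x : ℂ) • (errorOp ω x * ρ * (errorOp ω x).conjTranspose)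

/-- Trace-preserving completely positive linear maps.  Complete positivity: for every `m`, the map
`id_m ⊗ Φ`, i.e. `Φ` applied to all blocks of an `m × m` block matrix, preserves positive
semidefiniteness. -/
structure IsQuantumChannel {n : ℕ} (Φ : Op n →ₗ[ℂ] Op n) : Prop where
  trace_preserving : ∀ A : Op n, (Φ A).trace = A.trace
  completely_positive : ∀ (m : ℕ) (A : Matrix (Fin m) (Fin m) (Op n)),
    (Matrix.comp (Fin m) (Fin m) (Basis n) (Basis n) ℂ A).PosSemidef →
    (Matrix.comp (Fin m) (Fin m) (Basis n) (Basis n) ℂ (A.map Φ)).PosSemidef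

/-! ## Fidelity -/

/-- `⟨ψ| A |ψ⟩`. -/
def expval {n : ℕ} (A : Op n) (ψ : Qubits n) : ℂ :=
  star (ψ.ofLp) ⬝ᵥ (A.mulVec ψ.ofLp)

/-- `|ψ⟩⟨ψ|`. -/
def pureState {n : ℕ} (ψ : Qubits n) : Op n :=
  Matrix.vecMulVec ψ.ofLp (star ψ.ofLp)

/-- The minimum fidelity of the code `Q` over the depolarizing channel with the recovery
operator `R`: the minimum over unit vectors `ψ ∈ Q` of `⟨ψ| R(M(|ψ⟩⟨ψ|)) |ψ⟩`. -/
def minFidelity (ω : F4) (p : ℝ) {n : ℕ} (Q : Submodule ℂ (Qubits n))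
    (R : Op n →ₗ[ℂ] Op n) : ℝ :=
  ⨅ ψ : {ψ : Qubits n // ψ ∈ Q ∧ ‖ψ‖ = 1},
    (expval (R (depolarizing ω p (pureState ψ.1))) ψ.1).re

/-- The fidelity `F(Q)` of the code `Q` over the depolarizing channel: the minimum fidelity,
with the best recovery operator. -/
def fidelity (ω : F4) (p : ℝ) {n : ℕ} (Q : Submodule ℂ (Qubits n)) : ℝ :=
  ⨆ R : {R : Op n →ₗ[ℂ] Op n // IsQuantumChannel R}, minFidelity ω p Q R.1

/-! ## Stabilizer codes and quantum enumerators -/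

/-- `Q` is an `[[n,k]]` stabilizer code: there is an additive code `C` of size `2^(n+k)` with
`C^⊥ ⊆ C`, and a choice of signs `ε`, such that `Q` is the `2^k`-dimensional space of the vectors
fixed by all elements `ε(x) E_x`, `x ∈ C^⊥`, of the stabilizer group. -/
def IsStabilizerCode (ω : F4) (n k : ℕ) (Q : Submodule ℂ (Qubits n)) : Prop :=
  ∃ (C : AddSubgroup (Word n)) (ε : Word n → ℤˣ),
    Nat.card C = 2 ^ (n + k) ∧
    hermDual C ≤ C ∧
    (∀ ψ : Qubits n, ψ ∈ Q ↔
      ∀ x ∈ hermDual C, (((ε x : ℤ) : ℂ) • errorOp ω x).mulVec ψ.ofLp = ψ.ofLp) ∧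
    Module.finrank ℂ Q = 2 ^ k

/-- The orthogonal projector onto `Q`, as a matrix. -/
def proj {n : ℕ} (Q : Submodule ℂ (Qubits n)) : Op n :=
  (Matrix.toEuclideanCLM (n := Basis n) (𝕜 := ℂ)).symm Q.starProjection

/-- `B_j(Q) = (1 / dim Q) ∑_{wt x = j} Tr(E_x P E_x P)`.  (The traces are real.) -/
def enumB (ω : F4) {n : ℕ} (Q : Submodule ℂ (Qubits n)) (j : ℕ) : ℝ :=
  1 / (Module.finrank ℂ Q : ℝ) *
    ∑ x : Word n with hammingNorm x = j,
      ((errorOp ω x * proj Q * errorOp ω x * proj Q).trace).re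

/-- `B_j^⊥(Q) = (1 / (dim Q)²) ∑_{wt x = j} (Tr(E_x P))²`.  (The traces are real.) -/
def enumBperp (ω : F4) {n : ℕ} (Q : Submodule ℂ (Qubits n)) (j : ℕ) : ℝ :=
  1 / (Module.finrank ℂ Q : ℝ) ^ 2 *
    ∑ x : Word n with hammingNorm x = j, (((errorOp ω x * proj Q).trace) ^ 2).re

/-- The minimum distance of a quantum code: the smallest weight of an undetectable error, where
`E_x` is detectable if `P E_x P` is a scalar multiple of `P`.  It is `0` if there is no
undetectable error. -/
def minDist (ω : F4) {n : ℕ} (Q : Submodule ℂ (Qubits n)) : ℕ :=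
  sInf {w : ℕ | ∃ x : Word n, hammingNorm x = w ∧
    ¬ ∃ c : ℂ, proj Q * errorOp ω x * proj Q = c • proj Q}

/-! ## Ensembles and the bound -/

/-- The average of `f` over the finite ensemble `S`. -/
def average {α : Type*} (S : Finset α) (f : α → ℝ) : ℝ :=
  1 / (S.card : ℝ) * ∑ a ∈ S, f a

/-- `G(m,w) = ∑_{t=0}^{m} C(w,t) 2^t ∑_{h=⌈(w-t)/2⌉}^{m-t} C(w-t,h) C(n-w,m-t-h) 3^(m-t-h)`;
the terms with `t > w` vanish because `C(w,t) = 0`, so the truncated subtraction `w - t` is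
harmless, and `(w - t + 1) / 2` is `⌈(w-t)/2⌉`. -/
def G (n m w : ℕ) : ℕ :=
  ∑ t ∈ Finset.Icc 0 m, w.choose t * 2 ^ t *
    ∑ h ∈ Finset.Icc ((w - t + 1) / 2) (m - t),
      (w - t).choose h * (n - w).choose (m - t - h) * 3 ^ (m - t - h)

/-- `N̄(m) = ∑_{w = d_min}^{min(2m,n)} (B̄_w - B̄_w^⊥) G(m,w)`, with the average enumerators of the
ensemble `S`. -/
def avgN (ω : F4) {n : ℕ} (S : Finset (Submodule ℂ (Qubits n))) (d m : ℕ) : ℝ :=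
  ∑ w ∈ Finset.Icc d (min (2 * m) n),
    (average S (fun Q => enumB ω Q w) - average S (fun Q => enumBperp ω Q w)) * (G n m w : ℝ)

end

end StabFidelity

open StabFidelity

/-!
For a stabilizer code with additive code `C`, the operators `E_x` with `x ∈ C^⊥` act on the code
as signs, those with `x ∈ C` preserve it (they commute with the stabilizer), and those with
`x ∉ C` move it to an orthogonal space: since `C^⊥⊥ = C`, such an `E_x` anticommutes with some
stabilizer element, so `P E_x P = 0` (`Stabilizes.proj_mul_errorOp_mul_proj`). Hence errors in
distinct cosets of `C` have distinguishable effects, and the recovery that measures the coset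
and undoes its lightest element is a quantum channel with Kraus operators `P E_l`, one for each
coset leader `l`, and one projector that completes them (`Stabilizes.sum_decoder`).

This recovery corrects `x`, with leader `l`, whenever `x + l ∈ C^⊥`. Otherwise `e = x + l` lies in
`C \ C^⊥` and `wt (x + e) ≤ wt x`. So the fidelity loss is at most the probability of the words
`x` for which such an `e` exists (`Stabilizes.one_sub_fidelity_le`). For fixed `e` of weight `w`,
there are at most `G n m w` such words of weight `m` (`card_confusable_le`), and
`d(Q) ≤ w ≤ 2m`. The number of possible `e` of weight `w` is `B_w - B_w^⊥`
(`Stabilizes.enumB_sub_enumBperp`), because the trace in `B_w` is `dim Q` on `C` and `0` elsewhere,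
and the squared trace in `B_w^⊥` is `(dim Q)²` on `C^⊥` and `0` elsewhere. The union bound over `e`
bounds the loss of a single code, and the bound for the ensemble follows because the mean of minima
is at most the minimum of the means.
-/

namespace StabFidelity

open Matrix

/-! ### The field with four elements -/

lemma F4_card : Fintype.card F4 = 4 := by
  rw [← Nat.card_eq_fintype_card, GaloisField.card 2 2 (by norm_num)]; norm_num

lemma F4_add_self (a : F4) : a + a = 0 := CharTwo.add_self_eq_zero a

lemma word_add_self {n : ℕ} (x : Word n) : x + x = 0 := funext fun j => F4_add_self (x j)

lemma omega_sq {ω : F4} (hω0 : ω ≠ 0) (hω1 : ω ≠ 1) : ω ^ 2 = ω + 1 := by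
  have h4 : ω ^ 4 = ω := by simpa [F4_card] using FiniteField.pow_card ω
  have h : (ω * (ω - 1)) * (ω ^ 2 + ω + 1) = 0 := by linear_combination h4
  have h2 : ω ^ 2 + ω + 1 = 0 :=
    (mul_eq_zero.mp h).resolve_left (mul_ne_zero hω0 (sub_ne_zero.mpr hω1))
  linear_combination h2 - F4_add_self (ω + 1)

lemma F4_cases {ω : F4} (hω0 : ω ≠ 0) (hω1 : ω ≠ 1) (a : F4) :
    a = 0 ∨ a = 1 ∨ a = ω ∨ a = ω + 1 := by
  have h4 : a ^ 4 = a := by simpa [F4_card] using FiniteField.pow_card a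
  have h2 := omega_sq hω0 hω1
  have ht : (2 : F4) = 0 := CharTwo.two_eq_zero
  have h : a * ((a - 1) * ((a - ω) * (a - (ω + 1)))) = 0 := by
    linear_combination h4 + (a ^ 2 - a) * h2 + (a - a ^ 3 + ω * a ^ 2 - ω * a
      + (a * ω - a ^ 3 * ω) + (a ^ 2 + a ^ 2 * ω - a - a * ω)) * ht
  simpa [sub_eq_zero] using h

lemma omega_add_one_ne_zero {ω : F4} (hω1 : ω ≠ 1) : ω + 1 ≠ 0 := fun h =>
  hω1 (by linear_combination h - F4_add_self 1)

lemma trace_omega {ω : F4} (hω0 : ω ≠ 0) (hω1 : ω ≠ 1) :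
    Algebra.trace (ZMod 2) F4 ω = 1 := by
  have h := FiniteField.algebraMap_trace_eq_sum_pow (ZMod 2) F4 ω
  rw [GaloisField.finrank 2 (by norm_num)] at h
  have h1 : algebraMap (ZMod 2) F4 (Algebra.trace (ZMod 2) F4 ω) = algebraMap (ZMod 2) F4 1 := by
    rw [h]
    simp only [Nat.card_zmod, Finset.sum_range_succ, Finset.sum_range_zero, map_one]
    linear_combination omega_sq hω0 hω1 + F4_add_self ω
  exact (algebraMap (ZMod 2) F4).injective h1

lemma trace_one : Algebra.trace (ZMod 2) F4 1 = 0 := by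
  have h := Algebra.trace_algebraMap (S := F4) (1 : ZMod 2)
  rw [GaloisField.finrank 2 (by norm_num), map_one] at h
  rw [h]; decide

/-- On one coordinate the trace inner product records whether two distinct nonzero elements
meet, that is, whether the two Pauli matrices anticommute. -/
lemma trace_mul_sq {ω : F4} (hω0 : ω ≠ 0) (hω1 : ω ≠ 1) (a b : F4) :
    Algebra.trace (ZMod 2) F4 (a * b ^ 2) = if a = 0 ∨ b = 0 ∨ a = b then 0 else 1 := by
  have h2 := omega_sq hω0 hω1
  have h11 := F4_add_self 1
  have ht : (2 : F4) = 0 := CharTwo.two_eq_zero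
  have t1 := trace_omega hω0 hω1
  have t2 : Algebra.trace (ZMod 2) F4 (ω + 1) = 1 := by rw [map_add, t1, trace_one, add_zero]
  by_cases ha : a = 0
  · simp [ha]
  by_cases hb : b = 0
  · simp [hb]
  by_cases hab : a = b
  · subst hab
    have : a * a ^ 2 = 1 := by
      have h4 : a ^ 4 = a := by simpa [F4_card] using FiniteField.pow_card a
      exact mul_left_cancel₀ ha (by linear_combination h4)
    rw [this, trace_one]; simp
  rw [if_neg (by tauto)]
  rcases F4_cases hω0 hω1 a with rfl | rfl | rfl | rfl <;>
    rcases F4_cases hω0 hω1 b with rfl | rfl | rfl | rfl <;>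
    first
    | exact absurd rfl ha
    | exact absurd rfl hb
    | exact absurd rfl hab
    | skip
  · rwa [one_mul, h2]
  · rw [one_mul, show (ω + 1) ^ 2 = ω by linear_combination h2 + (ω + 1) * ht]; exact t1
  · rwa [one_pow, mul_one]
  · rw [show a * (a + 1) ^ 2 = a + 1 by linear_combination (a + 3) * h2 + (2 * a + 1) * ht]
    exact t2
  · rwa [one_pow, mul_one]
  · rw [show (b + 1) * b ^ 2 = b by linear_combination (b + 2) * h2 + (b + 1) * ht]; exact t1

/-! ### Pauli matrices -/

lemma pauli_zero (ω : F4) : pauli ω 0 = 1 := by simp [pauli]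

lemma pauli_one (ω : F4) : pauli ω 1 = !![0, 1; 1, 0] := by simp [pauli]

lemma pauli_omega {ω : F4} (hω0 : ω ≠ 0) (hω1 : ω ≠ 1) : pauli ω ω = !![1, 0; 0, -1] := by
  simp [pauli, hω0, hω1]

lemma pauli_omega_add_one {ω : F4} (hω0 : ω ≠ 0) (hω1 : ω ≠ 1) :
    pauli ω (ω + 1) = !![0, Complex.I; -Complex.I, 0] := by
  simp [pauli, hω0, omega_add_one_ne_zero hω1]

lemma pauli_conjTranspose (ω a : F4) : (pauli ω a)ᴴ = pauli ω a := by
  unfold pauli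
  split_ifs
  · simp
  all_goals
    ext i j
    fin_cases i <;> fin_cases j <;> simp

lemma pauli_mul_self (ω a : F4) : pauli ω a * pauli ω a = 1 := by
  unfold pauli
  split_ifs
  · simp
  all_goals
    ext i j
    fin_cases i <;> fin_cases j <;> simp [Matrix.mul_apply]

/-- The sign `(-1)^c` of `c ∈ 𝔽₂`. -/
noncomputable def sgn (c : ZMod 2) : ℂ := (-1) ^ c.val

lemma sgn_zero : sgn 0 = 1 := by simp [sgn]

lemma sgn_one : sgn 1 = -1 := by simp [sgn, ZMod.val_one]

lemma zmod_two_cases (c : ZMod 2) : c = 0 ∨ c = 1 := by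
  revert c; decide

lemma sgn_add (a b : ZMod 2) : sgn (a + b) = sgn a * sgn b := by
  rcases zmod_two_cases a with rfl | rfl <;> rcases zmod_two_cases b with rfl | rfl <;>
    simp [sgn_zero, sgn_one, show (1 + 1 : ZMod 2) = 0 by decide]

lemma sgn_sum {ι : Type*} (s : Finset ι) (f : ι → ZMod 2) :
    sgn (∑ i ∈ s, f i) = ∏ i ∈ s, sgn (f i) := by
  classical
  induction s using Finset.induction_on with
  | empty => simp [sgn_zero]
  | insert a s ha ih => rw [Finset.sum_insert ha, Finset.prod_insert ha, sgn_add, ih]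

/-- Up to a phase, the Pauli matrices multiply as `𝔽₄` adds. -/
lemma exists_pauli_mul {ω : F4} (hω0 : ω ≠ 0) (hω1 : ω ≠ 1) (a b : F4) :
    ∃ c : ℂ, ‖c‖ = 1 ∧ pauli ω a * pauli ω b = c • pauli ω (a + b) := by
  have p1 := pauli_one ω
  have p2 := pauli_omega hω0 hω1
  have p3 := pauli_omega_add_one hω0 hω1
  by_cases ha : a = 0
  · exact ⟨1, by simp, by simp [ha, pauli_zero]⟩
  by_cases hb : b = 0
  · exact ⟨1, by simp, by simp [hb, pauli_zero]⟩
  by_cases hab : a = b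
  · subst hab
    exact ⟨1, by simp, by rw [pauli_mul_self, F4_add_self, pauli_zero, one_smul]⟩
  have e1 : 1 + ω = ω + 1 := add_comm _ _
  have e2 : 1 + (ω + 1) = ω := by linear_combination F4_add_self 1
  have e3 : ω + (ω + 1) = 1 := by linear_combination F4_add_self ω
  have e4 : ω + 1 + 1 = ω := by linear_combination F4_add_self 1
  have e5 : ω + 1 + ω = 1 := by linear_combination F4_add_self ω
  rcases F4_cases hω0 hω1 a with h | h | h | h <;>
    rcases F4_cases hω0 hω1 b with h' | h' | h' | h' <;>
    first
    | exact absurd h ha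
    | exact absurd h' hb
    | exact absurd (h.trans h'.symm) hab
    | rw [h, h']
  · refine ⟨Complex.I, by simp, ?_⟩
    rw [e1, p1, p2, p3]
    ext i j; fin_cases i <;> fin_cases j <;> simp
  · refine ⟨-Complex.I, by simp, ?_⟩
    rw [e2, p1, p2, p3]
    ext i j; fin_cases i <;> fin_cases j <;> simp
  · refine ⟨-Complex.I, by simp, ?_⟩
    rw [p1, p2, p3]
    ext i j; fin_cases i <;> fin_cases j <;> simp
  · refine ⟨Complex.I, by simp, ?_⟩
    rw [e3, p1, p2, p3]
    ext i j; fin_cases i <;> fin_cases j <;> simp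
  · refine ⟨Complex.I, by simp, ?_⟩
    rw [e4, p1, p2, p3]
    ext i j; fin_cases i <;> fin_cases j <;> simp
  · refine ⟨-Complex.I, by simp, ?_⟩
    rw [e5, p1, p2, p3]
    ext i j; fin_cases i <;> fin_cases j <;> simp

lemma pauli_mul_comm {ω : F4} (hω0 : ω ≠ 0) (hω1 : ω ≠ 1) (a b : F4) :
    pauli ω a * pauli ω b =
      sgn (Algebra.trace (ZMod 2) F4 (a * b ^ 2)) • (pauli ω b * pauli ω a) := by
  have p1 := pauli_one ω
  have p2 := pauli_omega hω0 hω1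
  have p3 := pauli_omega_add_one hω0 hω1
  rw [trace_mul_sq hω0 hω1]
  by_cases ha : a = 0
  · simp [ha, pauli_zero, sgn_zero]
  by_cases hb : b = 0
  · simp [hb, pauli_zero, sgn_zero]
  by_cases hab : a = b
  · simp [hab, sgn_zero]
  rw [if_neg (by tauto), sgn_one]
  rcases F4_cases hω0 hω1 a with h | h | h | h <;>
    rcases F4_cases hω0 hω1 b with h' | h' | h' | h' <;>
    first
    | exact absurd h ha
    | exact absurd h' hb
    | exact absurd (h.trans h'.symm) hab
    | (rw [h, h']; simp only [p1, p2, p3]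
       ext i j; fin_cases i <;> fin_cases j <;> simp)

/-! ### Error operators -/

/-- The tensor product of `n` one-qubit operators, in the computational basis. -/
noncomputable def tensorOp {n : ℕ} (M : Fin n → Matrix (Fin 2) (Fin 2) ℂ) : Op n :=
  Matrix.of fun a b => ∏ j, M j (a j) (b j)

lemma tensorOp_mul {n : ℕ} (M N : Fin n → Matrix (Fin 2) (Fin 2) ℂ) :
    tensorOp M * tensorOp N = tensorOp fun j => M j * N j := by
  ext a b
  simp only [tensorOp, Matrix.mul_apply, Matrix.of_apply, ← Finset.prod_mul_distrib]
  exact (Fintype.prod_sum fun j c => M j (a j) c * N j c (b j)).symm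

lemma tensorOp_smul {n : ℕ} (c : Fin n → ℂ) (M : Fin n → Matrix (Fin 2) (Fin 2) ℂ) :
    tensorOp (fun j => c j • M j) = (∏ j, c j) • tensorOp M := by
  ext a b
  simp [tensorOp, Finset.prod_mul_distrib]

lemma tensorOp_one (n : ℕ) : tensorOp (fun _ : Fin n => 1) = 1 := by
  ext a b
  simp only [tensorOp, Matrix.of_apply, Matrix.one_apply, Fintype.prod_boole, funext_iff]
  congr

lemma errorOp_eq (ω : F4) {n : ℕ} (x : Word n) :
    errorOp ω x = tensorOp fun j => pauli ω (x j) := rfl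

lemma errorOp_conjTranspose (ω : F4) {n : ℕ} (x : Word n) : (errorOp ω x)ᴴ = errorOp ω x := by
  ext a b
  simp only [Matrix.conjTranspose_apply, errorOp, Matrix.of_apply, star_prod]
  refine Finset.prod_congr rfl fun j _ => ?_
  conv_rhs => rw [← pauli_conjTranspose, Matrix.conjTranspose_apply]

lemma errorOp_mul_self (ω : F4) {n : ℕ} (x : Word n) : errorOp ω x * errorOp ω x = 1 := by
  simp only [errorOp_eq, tensorOp_mul, pauli_mul_self, tensorOp_one]

lemma exists_errorOp_mul {ω : F4} (hω0 : ω ≠ 0) (hω1 : ω ≠ 1) {n : ℕ} (x y : Word n) :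
    ∃ c : ℂ, ‖c‖ = 1 ∧ errorOp ω x * errorOp ω y = c • errorOp ω (x + y) := by
  choose c hc hm using fun j => exists_pauli_mul hω0 hω1 (x j) (y j)
  refine ⟨∏ j, c j, by simp [hc], ?_⟩
  simp only [errorOp_eq, tensorOp_mul, hm, tensorOp_smul, Pi.add_apply]

lemma errorOp_mul_comm {ω : F4} (hω0 : ω ≠ 0) (hω1 : ω ≠ 1) {n : ℕ} (x y : Word n) :
    errorOp ω x * errorOp ω y = sgn (traceInner x y) • (errorOp ω y * errorOp ω x) := by
  rw [traceInner, map_sum, sgn_sum]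
  simp only [errorOp_eq, tensorOp_mul]
  rw [← tensorOp_smul]
  simp only [← pauli_mul_comm hω0 hω1]

/-! ### Duality of additive codes -/

/-- The trace inner product as an `𝔽₂`-bilinear form. -/
noncomputable def traceForm (n : ℕ) : LinearMap.BilinForm (ZMod 2) (Word n) :=
  AddMonoidHom.toZModLinearMap 2
    { toFun := fun x => AddMonoidHom.toZModLinearMap 2
        { toFun := fun y => traceInner x y
          map_zero' := by simp [traceInner]
          map_add' := fun y z => by
            simp [traceInner, add_sq, mul_add, Finset.sum_add_distrib, CharTwo.two_eq_zero] }
      map_zero' := by ext y; simp [traceInner]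
      map_add' := fun x y => by
        ext z; simp [traceInner, add_mul, Finset.sum_add_distrib] }

lemma traceInner_comm {ω : F4} (hω0 : ω ≠ 0) (hω1 : ω ≠ 1) {n : ℕ} (x y : Word n) :
    traceInner x y = traceInner y x := by
  simp only [traceInner, map_sum, trace_mul_sq hω0 hω1]
  refine Finset.sum_congr rfl fun j _ => ?_
  congr 1
  grind

lemma exists_traceInner_ne_zero {ω : F4} (hω0 : ω ≠ 0) (hω1 : ω ≠ 1) {n : ℕ} {x : Word n}
    (hx : x ≠ 0) : ∃ y, traceInner x y ≠ 0 := by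
  obtain ⟨j, hj⟩ := Function.ne_iff.mp hx
  have hj' : x j ≠ 0 := hj
  obtain ⟨b, hb0, hb⟩ : ∃ b : F4, b ≠ 0 ∧ x j ≠ b := by
    by_cases h : x j = 1
    · exact ⟨ω, hω0, fun h' => hω1 (h'.symm.trans h)⟩
    · exact ⟨1, one_ne_zero, h⟩
  refine ⟨Pi.single j b, ?_⟩
  rw [traceInner, map_sum, Finset.sum_eq_single j]
  · rw [Pi.single_eq_same, trace_mul_sq hω0 hω1, if_neg (by tauto)]
    exact one_ne_zero
  · intro i _ hij
    simp [Pi.single_eq_of_ne hij]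
  · simp

/-- An additive code is its own double dual; in the form needed here, a word outside `C` has
nonzero inner product with a word of `C^⊥`. -/
lemma exists_mem_hermDual {ω : F4} (hω0 : ω ≠ 0) (hω1 : ω ≠ 1) {n : ℕ}
    {C : AddSubgroup (Word n)} {x : Word n} (hx : x ∉ C) :
    ∃ y ∈ hermDual C, traceInner x y ≠ 0 := by
  by_contra! h
  have hsymm : (traceForm n).IsSymm := ⟨fun x y => traceInner_comm hω0 hω1 x y⟩
  have hnd : (traceForm n).Nondegenerate := by
    refine hsymm.isRefl.nondegenerate_iff_separatingLeft.mpr ?_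
    intro x hx
    by_contra h0
    obtain ⟨y, hy⟩ := exists_traceInner_ne_zero hω0 hω1 h0
    exact hy (hx y)
  have hdd := LinearMap.BilinForm.orthogonal_orthogonal hnd hsymm.isRefl
    (AddSubgroup.toZModSubmodule 2 C)
  refine hx ?_
  rw [← AddSubgroup.mem_toZModSubmodule (n := 2), ← hdd]
  intro y hy
  change traceInner y x = 0
  rw [traceInner_comm hω0 hω1]
  refine h y fun z hz => ?_
  rw [traceInner_comm hω0 hω1]
  exact hy z hz

/-! ### The projector onto a code -/

lemma proj_mulVec {n : ℕ} (Q : Submodule ℂ (Qubits n)) (ψ : Qubits n) :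
    proj Q *ᵥ ψ.ofLp = (Q.starProjection ψ).ofLp := by
  have h : Matrix.toEuclideanCLM (n := Basis n) (𝕜 := ℂ) (proj Q) = Q.starProjection :=
    StarAlgEquiv.apply_symm_apply _ _
  rw [← Matrix.ofLp_toEuclideanCLM, h]

lemma proj_mulVec_of_mem {n : ℕ} {Q : Submodule ℂ (Qubits n)} {ψ : Qubits n} (h : ψ ∈ Q) :
    proj Q *ᵥ ψ.ofLp = ψ.ofLp := by
  rw [proj_mulVec, Submodule.starProjection_eq_self_iff.mpr h]

lemma proj_conjTranspose {n : ℕ} (Q : Submodule ℂ (Qubits n)) : (proj Q)ᴴ = proj Q := by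
  rw [← Matrix.star_eq_conjTranspose, proj]
  refine ((Matrix.toEuclideanCLM (n := Basis n) (𝕜 := ℂ)).symm.map_star' _).symm.trans ?_
  exact congrArg _ (isSelfAdjoint_starProjection Q)

lemma proj_mul_proj {n : ℕ} (Q : Submodule ℂ (Qubits n)) : proj Q * proj Q = proj Q := by
  rw [proj, ← map_mul]
  congr 1
  exact Q.isIdempotentElem_starProjection

lemma trace_proj {n : ℕ} (Q : Submodule ℂ (Qubits n)) :
    (proj Q).trace = Module.finrank ℂ Q := by
  have h : LinearMap.IsProj Q (Q.starProjection : Qubits n →ₗ[ℂ] Qubits n) :=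
    ⟨fun x => Q.starProjection_apply_mem x,
      fun x hx => Submodule.starProjection_eq_self_iff.mpr hx⟩
  rw [← h.trace, LinearMap.trace_eq_matrix_trace ℂ (EuclideanSpace.basisFun (Basis n) ℂ).toBasis]
  congr

/-- An operator is fixed by left multiplication with the projector as soon as its range lies in
the code. -/
lemma proj_mul_of_mem {n : ℕ} {Q : Submodule ℂ (Qubits n)} {A : Op n}
    (h : ∀ v : Basis n → ℂ, WithLp.toLp 2 (A *ᵥ v) ∈ Q) : proj Q * A = A := by
  refine Matrix.ext_of_mulVec_single fun a => ?_
  rw [← Matrix.mulVec_mulVec]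
  exact proj_mulVec_of_mem (h _)

/-! ### Stabilizer codes -/

/-- The additive code `C` with signs `ε` describes the stabilizer code `Q`: the inclusion
`C^⊥ ⊆ C`, and `Q` as the common fixed space of the `ε(x) E_x`, `x ∈ C^⊥`. -/
structure Stabilizes (ω : F4) {n : ℕ} (C : AddSubgroup (Word n)) (ε : Word n → ℤˣ)
    (Q : Submodule ℂ (Qubits n)) : Prop where
  dual_le : hermDual C ≤ C
  mem_iff : ∀ ψ : Qubits n, ψ ∈ Q ↔
    ∀ x ∈ hermDual C, (((ε x : ℤ) : ℂ) • errorOp ω x).mulVec ψ.ofLp = ψ.ofLp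

lemma sign_mul_self (u : ℤˣ) : ((u : ℤ) : ℂ) * ((u : ℤ) : ℂ) = 1 := by
  rcases Int.units_eq_one_or u with rfl | rfl <;> simp

namespace Stabilizes

variable {ω : F4} {n : ℕ} {C : AddSubgroup (Word n)} {ε : Word n → ℤˣ}
  {Q : Submodule ℂ (Qubits n)}

lemma errorOp_mulVec (h : Stabilizes ω C ε Q) {x : Word n} (hx : x ∈ hermDual C)
    {ψ : Qubits n} (hψ : ψ ∈ Q) : errorOp ω x *ᵥ ψ.ofLp = ((ε x : ℤ) : ℂ) • ψ.ofLp := by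
  have h1 := (h.mem_iff ψ).mp hψ x hx
  conv_rhs => rw [← h1]
  rw [Matrix.smul_mulVec, smul_smul, sign_mul_self, one_smul]

lemma errorOp_mul_proj (h : Stabilizes ω C ε Q) {x : Word n} (hx : x ∈ hermDual C) :
    errorOp ω x * proj Q = ((ε x : ℤ) : ℂ) • proj Q := by
  refine Matrix.ext_of_mulVec_single fun a => ?_
  rw [← Matrix.mulVec_mulVec, Matrix.smul_mulVec]
  have := proj_mulVec Q (WithLp.toLp 2 (Pi.single a 1))
  simp only at this
  rw [this]
  exact h.errorOp_mulVec hx (Q.starProjection_apply_mem _)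

/-- Errors in `C` preserve the code, because they commute with the stabilizer. -/
lemma errorOp_mulVec_mem (hω0 : ω ≠ 0) (hω1 : ω ≠ 1) (h : Stabilizes ω C ε Q) {x : Word n}
    (hx : x ∈ C) {ψ : Qubits n} (hψ : ψ ∈ Q) : WithLp.toLp 2 (errorOp ω x *ᵥ ψ.ofLp) ∈ Q := by
  rw [h.mem_iff]
  intro y hy
  have hc : errorOp ω y * errorOp ω x = errorOp ω x * errorOp ω y := by
    rw [errorOp_mul_comm hω0 hω1 y x, hy x hx, sgn_zero, one_smul]
  rw [Matrix.mulVec_mulVec, Matrix.smul_mul, hc, Matrix.smul_mulVec, ← Matrix.mulVec_mulVec,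
    h.errorOp_mulVec hy hψ, Matrix.mulVec_smul, smul_smul, sign_mul_self, one_smul]

lemma commute_proj (hω0 : ω ≠ 0) (hω1 : ω ≠ 1) (h : Stabilizes ω C ε Q) {x : Word n}
    (hx : x ∈ C) : errorOp ω x * proj Q = proj Q * errorOp ω x := by
  have h1 : proj Q * (errorOp ω x * proj Q) = errorOp ω x * proj Q := by
    refine proj_mul_of_mem fun v => ?_
    rw [← Matrix.mulVec_mulVec]
    have := proj_mulVec Q (WithLp.toLp 2 v)
    simp only at this
    rw [this]
    exact h.errorOp_mulVec_mem hω0 hω1 hx (Q.starProjection_apply_mem _)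
  have h2 := congrArg Matrix.conjTranspose h1
  simp only [Matrix.conjTranspose_mul, proj_conjTranspose, errorOp_conjTranspose] at h2
  rw [← h1, ← h2, Matrix.mul_assoc]

/-- Errors outside `C` move the code to an orthogonal space, because they anticommute with an
element of the stabilizer. -/
lemma proj_mul_errorOp_mul_proj (hω0 : ω ≠ 0) (hω1 : ω ≠ 1) (h : Stabilizes ω C ε Q)
    {x : Word n} (hx : x ∉ C) : proj Q * errorOp ω x * proj Q = 0 := by
  obtain ⟨y, hy, hxy⟩ := exists_mem_hermDual hω0 hω1 hx
  have hxy' := (zmod_two_cases _).resolve_left hxy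
  have hP := h.errorOp_mul_proj hy
  have hP' : proj Q * errorOp ω y = ((ε y : ℤ) : ℂ) • proj Q := by
    rw [← h.commute_proj hω0 hω1 (h.dual_le hy), hP]
  have hne : ((ε y : ℤ) : ℂ) ≠ 0 := left_ne_zero_of_mul_eq_one (sign_mul_self (ε y))
  have h1 : ((ε y : ℤ) : ℂ) • (proj Q * errorOp ω x * proj Q)
      = -(((ε y : ℤ) : ℂ) • (proj Q * errorOp ω x * proj Q)) :=
    calc ((ε y : ℤ) : ℂ) • (proj Q * errorOp ω x * proj Q)
        = proj Q * (errorOp ω x * errorOp ω y) * proj Q := by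
          rw [← Matrix.mul_smul, ← hP]; simp only [Matrix.mul_assoc]
      _ = -((proj Q * errorOp ω y) * errorOp ω x * proj Q) := by
          rw [errorOp_mul_comm hω0 hω1 x y, hxy', sgn_one]
          simp only [Matrix.mul_assoc, neg_smul, one_smul, Matrix.mul_neg, Matrix.neg_mul]
      _ = _ := by rw [hP']; simp only [Matrix.smul_mul]
  refine (smul_eq_zero.mp ?_).resolve_left hne
  ext a b
  exact self_eq_neg.mp (congrFun (congrFun h1 a) b)

/-- Errors outside `C^⊥` are traceless on the code: those outside `C` because they move
it to an orthogonal space, those in `C` by conjugation with an element of `C` that anticommutes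
with them. -/
lemma trace_errorOp_mul_proj (hω0 : ω ≠ 0) (hω1 : ω ≠ 1) (h : Stabilizes ω C ε Q)
    {x : Word n} (hx : x ∉ hermDual C) : (errorOp ω x * proj Q).trace = 0 := by
  by_cases hxC : x ∈ C
  · obtain ⟨y, hy, hxy⟩ : ∃ y ∈ C, traceInner x y ≠ 0 := by
      by_contra! h'
      exact hx h'
    have hxy' := (zmod_two_cases _).resolve_left hxy
    refine self_eq_neg.mp ?_
    calc (errorOp ω x * proj Q).trace
        = (errorOp ω x * (errorOp ω y * errorOp ω y) * proj Q).trace := by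
          rw [errorOp_mul_self, Matrix.mul_one]
      _ = -((errorOp ω y * (errorOp ω x * (errorOp ω y * proj Q))).trace) := by
          rw [← Matrix.mul_assoc, errorOp_mul_comm hω0 hω1 x y, hxy', sgn_one]
          simp only [Matrix.mul_assoc, neg_smul, one_smul, Matrix.neg_mul, Matrix.trace_neg]
      _ = -((errorOp ω x * proj Q).trace) := by
          rw [Matrix.trace_mul_comm, h.commute_proj hω0 hω1 hy, Matrix.mul_assoc,
            Matrix.mul_assoc, errorOp_mul_self, Matrix.mul_one]
  · rw [← proj_mul_proj, ← Matrix.mul_assoc, Matrix.trace_mul_comm, ← Matrix.mul_assoc,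
      h.proj_mul_errorOp_mul_proj hω0 hω1 hxC, Matrix.trace_zero]

/-! ### Enumerators and minimum distance of a stabilizer code -/

/-- The words of `C` outside `C^⊥`, that is, the undetectable errors of the code. -/
noncomputable def logicals (C : AddSubgroup (Word n)) : Finset (Word n) :=
  by classical exact Finset.univ.filter fun x => x ∈ C ∧ x ∉ hermDual C

lemma mem_logicals {x : Word n} : x ∈ logicals C ↔ x ∈ C ∧ x ∉ hermDual C := by
  simp [logicals]

lemma enumB_sub_enumBperp (hω0 : ω ≠ 0) (hω1 : ω ≠ 1) (h : Stabilizes ω C ε Q)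
    (hQ : Module.finrank ℂ Q ≠ 0) (w : ℕ) :
    enumB ω Q w - enumBperp ω Q w = ((logicals C).filter fun x => hammingNorm x = w).card := by
  classical
  have hQ' : (Module.finrank ℂ Q : ℝ) ≠ 0 := Nat.cast_ne_zero.mpr hQ
  rw [enumB, enumBperp, Finset.mul_sum, Finset.mul_sum, ← Finset.sum_sub_distrib,
    Finset.card_filter, logicals, Finset.sum_filter, Finset.sum_filter, Nat.cast_sum]
  refine Finset.sum_congr rfl fun x _ => ?_
  by_cases hw : hammingNorm x = w
  swap
  · simp [hw]
  by_cases hx : x ∈ hermDual C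
  · have hxC := h.dual_le hx
    have h1 : errorOp ω x * proj Q * errorOp ω x * proj Q = proj Q := by
      rw [Matrix.mul_assoc, h.errorOp_mul_proj hx, Matrix.smul_mul, Matrix.mul_smul, smul_smul,
        sign_mul_self, one_smul, proj_mul_proj]
    have h2 : (errorOp ω x * proj Q).trace ^ 2 = (Module.finrank ℂ Q : ℂ) ^ 2 := by
      rw [h.errorOp_mul_proj hx, Matrix.trace_smul, trace_proj, smul_eq_mul, mul_pow, sq (_ : ℂ),
        sign_mul_self, one_mul]
    have h3 : ((Module.finrank ℂ Q : ℂ) ^ 2).re = (Module.finrank ℂ Q : ℝ) ^ 2 := by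
      norm_cast
    simp [hw, hx, h1, h2, h3, trace_proj, hQ']
  · have h0 := h.trace_errorOp_mul_proj hω0 hω1 hx
    by_cases hxC : x ∈ C
    · have h1 : errorOp ω x * proj Q * errorOp ω x * proj Q = proj Q := by
        rw [h.commute_proj hω0 hω1 hxC, Matrix.mul_assoc (proj Q), errorOp_mul_self,
          Matrix.mul_one, proj_mul_proj]
      simp [hw, hx, hxC, h0, h1, trace_proj, hQ']
    · have h1 : errorOp ω x * proj Q * errorOp ω x * proj Q = 0 := by
        rw [Matrix.mul_assoc, Matrix.mul_assoc, ← Matrix.mul_assoc (proj Q),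
          h.proj_mul_errorOp_mul_proj hω0 hω1 hxC, Matrix.mul_zero]
      simp [hw, hx, hxC, h0, h1]

lemma minDist_le (hω0 : ω ≠ 0) (hω1 : ω ≠ 1) (h : Stabilizes ω C ε Q)
    (hQ : Module.finrank ℂ Q ≠ 0) {x : Word n} (hx : x ∈ logicals C) :
    minDist ω Q ≤ hammingNorm x := by
  rw [mem_logicals] at hx
  refine Nat.sInf_le ⟨x, rfl, ?_⟩
  rintro ⟨c, hc⟩
  have hQ' : (Module.finrank ℂ Q : ℂ) ≠ 0 := Nat.cast_ne_zero.mpr hQ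
  rw [← h.commute_proj hω0 hω1 hx.1, Matrix.mul_assoc, proj_mul_proj] at hc
  have h1 := congrArg Matrix.trace hc
  rw [h.trace_errorOp_mul_proj hω0 hω1 hx.2, Matrix.trace_smul, trace_proj, smul_eq_mul,
    zero_eq_mul] at h1
  have hc0 := h1.resolve_right hQ'
  have h2 : proj Q = 0 := by
    rw [← Matrix.one_mul (proj Q), ← errorOp_mul_self ω x, Matrix.mul_assoc, hc, hc0, zero_smul,
      Matrix.mul_zero]
  exact hQ' (by rw [← trace_proj, h2, Matrix.trace_zero])

end Stabilizes

/-! ### Counting errors of given weight -/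

lemma card_compl_pair {a : F4} (ha : a ≠ 0) : (({0, a} : Finset F4)ᶜ).card = 2 := by
  rw [Finset.card_compl, F4_card, Finset.card_pair ha.symm]

lemma card_compl_zero : (({0} : Finset F4)ᶜ).card = 3 := by
  rw [Finset.card_compl, F4_card, Finset.card_singleton]

/-- The words that differ from both `0` and `e` on `T`, agree with `e` on `H`, are nonzero
on `O`, and vanish elsewhere. -/
noncomputable def box {n : ℕ} (e : Word n) (T H O : Finset (Fin n)) : Finset (Word n) :=
  Fintype.piFinset fun j =>
    if j ∈ T then {0, e j}ᶜ else if j ∈ H then {e j} else if j ∈ O then {0}ᶜ else {0}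

lemma card_box {n : ℕ} (e : Word n) {T H O : Finset (Fin n)} (hT : ∀ j ∈ T, e j ≠ 0)
    (hH : ∀ j ∈ H, e j ≠ 0) (hO : ∀ j ∈ O, e j = 0) :
    (box e T H O).card = 2 ^ T.card * 3 ^ O.card := by
  have h2 : (2 : ℕ) ^ T.card = ∏ j, if j ∈ T then 2 else 1 := by
    rw [Finset.prod_ite_mem, Finset.univ_inter, Finset.prod_const]
  have h3 : (3 : ℕ) ^ O.card = ∏ j, if j ∈ O then 3 else 1 := by
    rw [Finset.prod_ite_mem, Finset.univ_inter, Finset.prod_const]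
  rw [box, Fintype.card_piFinset, h2, h3, ← Finset.prod_mul_distrib]
  refine Finset.prod_congr rfl fun j _ => ?_
  by_cases hjT : j ∈ T
  · have hjO : j ∉ O := fun h => hT j hjT (hO j h)
    rw [if_pos hjT, if_pos hjT, if_neg hjO, card_compl_pair (hT j hjT),
      mul_one]
  by_cases hjH : j ∈ H
  · have hjO : j ∉ O := fun h => hH j hjH (hO j h)
    simp [hjT, hjH, hjO]
  by_cases hjO : j ∈ O
  · simp [hjT, hjH, hjO, card_compl_zero]
  · simp [hjT, hjH, hjO]

/-- Classifying an error `x` by the places where it agrees with `e` or differs from it, `G`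
counts the errors of weight `m` whose translate by `e` is at most as heavy. -/
lemma card_confusable_le {n : ℕ} (e : Word n) (m : ℕ) :
    (Finset.univ.filter fun x : Word n => hammingNorm x = m ∧ hammingNorm (x + e) ≤ m).card
      ≤ G n m (hammingNorm e) := by
  set S : Finset (Fin n) := Finset.univ.filter fun j => e j ≠ 0 with hS
  have hw : hammingNorm e = S.card := rfl
  rw [hw]
  have hsub : (Finset.univ.filter fun x : Word n => hammingNorm x = m ∧ hammingNorm (x + e) ≤ m)
      ⊆ (Finset.Icc 0 m).biUnion fun t => (S.powersetCard t).biUnion fun T =>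
        (Finset.Icc ((S.card - t + 1) / 2) (m - t)).biUnion fun h =>
        ((S \ T).powersetCard h).biUnion fun H =>
        (Sᶜ.powersetCard (m - t - h)).biUnion fun O => box e T H O := by
    intro x hx
    obtain ⟨hxm, hxe⟩ := (Finset.mem_filter.mp hx).2
    -- on the support of `e`, the entry of `x` may be neither `0` nor that of `e` (`T`), that of
    -- `e` (`H`), or `0` (`Z`); `O` is the rest of the support of `x`
    set T : Finset (Fin n) := Finset.univ.filter fun j => e j ≠ 0 ∧ x j ≠ 0 ∧ x j ≠ e j with hT
    set H : Finset (Fin n) := Finset.univ.filter fun j => e j ≠ 0 ∧ x j = e j with hH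
    set O : Finset (Fin n) := Finset.univ.filter fun j => e j = 0 ∧ x j ≠ 0 with hO
    set Z : Finset (Fin n) := Finset.univ.filter fun j => e j ≠ 0 ∧ x j = 0 with hZ
    have c1 : hammingNorm x = T.card + H.card + O.card := by
      simp only [hammingNorm, hT, hH, hO, Finset.card_filter, ← Finset.sum_add_distrib]
      refine Finset.sum_congr rfl fun j _ => ?_
      by_cases h1 : e j = 0 <;> by_cases h2 : x j = 0 <;> by_cases h3 : x j = e j <;> grind
    have c2 : S.card = T.card + H.card + Z.card := by
      simp only [hS, hT, hH, hZ, Finset.card_filter, ← Finset.sum_add_distrib]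
      refine Finset.sum_congr rfl fun j _ => ?_
      by_cases h1 : e j = 0 <;> by_cases h2 : x j = 0 <;> by_cases h3 : x j = e j <;> grind
    have c3 : hammingNorm (x + e) = T.card + O.card + Z.card := by
      simp only [hammingNorm, hT, hO, hZ, Finset.card_filter, ← Finset.sum_add_distrib]
      refine Finset.sum_congr rfl fun j _ => ?_
      have h0 : (x + e) j = 0 ↔ x j = e j := CharTwo.add_eq_zero
      by_cases h1 : e j = 0 <;> by_cases h2 : x j = 0 <;> by_cases h3 : x j = e j <;> grind
    simp only [Finset.mem_biUnion, Finset.mem_Icc, Finset.mem_powersetCard]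
    refine ⟨T.card, ⟨by lia, by lia⟩, T, ⟨by grind, rfl⟩, H.card, ⟨by lia, by lia⟩, H,
      ⟨by grind, rfl⟩, O, ⟨fun j hj => ?_, by lia⟩, ?_⟩
    · simpa [hS] using (Finset.mem_filter.mp hj).2.1
    rw [box, Fintype.mem_piFinset]
    intro j
    by_cases h1 : e j = 0 <;> by_cases h2 : x j = 0 <;> by_cases h3 : x j = e j <;>
      simp_all
  refine (Finset.card_le_card hsub).trans ?_
  rw [G]
  refine Finset.card_biUnion_le.trans (Finset.sum_le_sum fun t _ => ?_)
  have hcS : Sᶜ.card = n - S.card := by rw [Finset.card_compl, Fintype.card_fin]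
  rw [mul_assoc, ← Finset.card_powersetCard, ← smul_eq_mul, ← Finset.sum_const]
  refine Finset.card_biUnion_le.trans (Finset.sum_le_sum fun T hT => ?_)
  obtain ⟨hTS, hTt⟩ := Finset.mem_powersetCard.mp hT
  rw [Finset.mul_sum]
  refine Finset.card_biUnion_le.trans (Finset.sum_le_sum fun h _ => ?_)
  have hcT : (S \ T).card = S.card - t := by rw [Finset.card_sdiff_of_subset hTS, hTt]
  have hval : 2 ^ t * ((S.card - t).choose h * (n - S.card).choose (m - t - h) * 3 ^ (m - t - h))
      = ∑ _H ∈ (S \ T).powersetCard h, ∑ _O ∈ Sᶜ.powersetCard (m - t - h),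
        2 ^ t * 3 ^ (m - t - h) := by
    simp only [Finset.sum_const, Finset.card_powersetCard, hcT, hcS, smul_eq_mul]
    ring
  rw [hval]
  refine Finset.card_biUnion_le.trans (Finset.sum_le_sum fun H hH => ?_)
  refine Finset.card_biUnion_le.trans (Finset.sum_le_sum fun O hO => ?_)
  obtain ⟨hHS, -⟩ := Finset.mem_powersetCard.mp hH
  obtain ⟨hOS, hOc⟩ := Finset.mem_powersetCard.mp hO
  rw [card_box e (fun j hj => ?_) (fun j hj => ?_) fun j hj => ?_, hTt, hOc]
  · exact (Finset.mem_filter.mp (hTS hj)).2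
  · exact (Finset.mem_filter.mp (Finset.mem_sdiff.mp (hHS hj)).1).2
  · simpa [hS] using hOS hj

lemma G_zero (n m : ℕ) : G n m 0 = n.choose m * 3 ^ m := by
  have h0 : ∀ i ∈ Finset.Icc 0 m, i ≠ 0 → Nat.choose 0 i = 0 := fun i _ hi =>
    Nat.choose_eq_zero_of_lt (Nat.pos_of_ne_zero hi)
  rw [G, Finset.sum_eq_single 0 (fun t ht h => by rw [h0 t ht h]; simp) (by simp)]
  simp only [Nat.sub_zero, Nat.choose_self, pow_zero, Nat.zero_add, one_mul]
  rw [show 1 / 2 = 0 from rfl,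
    Finset.sum_eq_single 0 (fun h hh hne => by rw [h0 h hh hne]; simp) (by simp)]
  simp

/-- This is the case `e = 0` of `card_confusable_le`, where the second weight condition is void. -/
lemma card_hammingNorm_eq_le (n m : ℕ) :
    (Finset.univ.filter fun x : Word n => hammingNorm x = m).card ≤ n.choose m * 3 ^ m := by
  rw [← G_zero, ← hammingNorm_zero (β := fun _ : Fin n => F4)]
  refine le_trans (Finset.card_le_card fun x hx => ?_) (card_confusable_le (0 : Word n) m)
  simp only [Finset.mem_filter] at hx ⊢
  simp [hx.2]

/-! ### Error probabilities -/

lemma errorProb_nonneg {p : ℝ} (hp0 : 0 ≤ p) (hp1 : p ≤ 1) {n : ℕ} (x : Word n) :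
    0 ≤ errorProb p x := by
  have : 0 ≤ 1 - p := by linarith
  unfold errorProb
  positivity

/-- The error probability is a product over the coordinates, each factor summing to
`(1 - p) + 3 (p / 3)`. -/
lemma sum_errorProb (p : ℝ) (n : ℕ) : ∑ x : Word n, errorProb p x = 1 := by
  have h1 : ∀ x : Word n, errorProb p x = ∏ j, if x j ≠ 0 then p / 3 else 1 - p := by
    intro x
    rw [Finset.prod_ite, Finset.prod_const, Finset.prod_const, errorProb, hammingNorm]
    congr 2
    have := Finset.card_filter_add_card_filter_not (s := Finset.univ) fun j => x j ≠ 0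
    rw [Finset.card_univ, Fintype.card_fin] at this
    lia
  simp only [h1]
  rw [← Fintype.prod_sum fun (_ : Fin n) (a : F4) => if a ≠ 0 then p / 3 else 1 - p]
  have h2 : ∑ a : F4, (if a ≠ 0 then p / 3 else 1 - p) = 1 := by
    rw [Finset.sum_ite, Finset.sum_const, Finset.sum_const]
    have e1 : (Finset.univ.filter fun a : F4 => a ≠ 0).card = 3 := by
      rw [← card_compl_zero]; congr 1; ext a; simp
    have e2 : (Finset.univ.filter fun a : F4 => ¬ a ≠ 0).card = 1 := by
      rw [← Finset.card_singleton (0 : F4)]; congr 1; ext a; simp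
    rw [e1, e2]
    simp only [nsmul_eq_mul]
    push_cast
    ring
  rw [Finset.prod_const, h2, one_pow]

/-! ### Quantum channels -/

/-- The operation `ρ ↦ ∑ᵢ Kᵢ ρ Kᵢ†` with Kraus operators `Kᵢ`. -/
noncomputable def krausMap {n : ℕ} {ι : Type*} [Fintype ι] (K : ι → Op n) : Op n →ₗ[ℂ] Op n where
  toFun ρ := ∑ i, K i * ρ * (K i)ᴴ
  map_add' ρ σ := by simp only [Matrix.mul_add, Matrix.add_mul, Finset.sum_add_distrib]
  map_smul' c ρ := by
    simp only [Matrix.mul_smul, Matrix.smul_mul, Finset.smul_sum, RingHom.id_apply]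

lemma krausMap_apply {n : ℕ} {ι : Type*} [Fintype ι] (K : ι → Op n) (ρ : Op n) :
    krausMap K ρ = ∑ i, K i * ρ * (K i)ᴴ := rfl

lemma isQuantumChannel_krausMap {n : ℕ} {ι : Type*} [Fintype ι] {K : ι → Op n}
    (hK : ∑ i, (K i)ᴴ * K i = 1) : IsQuantumChannel (krausMap K) where
  trace_preserving ρ := by
    have h : ∀ i, (K i * ρ * (K i)ᴴ).trace = ((K i)ᴴ * K i * ρ).trace := fun i => by
      rw [Matrix.trace_mul_comm, Matrix.mul_assoc]
    rw [krausMap_apply, Matrix.trace_sum, Finset.sum_congr rfl fun i _ => h i, ← Matrix.trace_sum,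
      ← Finset.sum_mul, hK, Matrix.one_mul]
  completely_positive m A hA := by
    -- `id_m ⊗ krausMap K` conjugates by the block diagonal operators `1 ⊗ Kᵢ`
    have hmap : A.map (krausMap K) = ∑ i,
        Matrix.diagonal (fun _ => K i) * A * Matrix.diagonal (fun _ => (K i)ᴴ) := by
      ext a b : 2
      simp [krausMap_apply, Matrix.sum_apply, Matrix.diagonal_mul, Matrix.mul_diagonal]
    rw [hmap, ← Matrix.compRingEquiv_apply, map_sum]
    refine Matrix.posSemidef_sum _ fun i _ => ?_
    rw [map_mul, map_mul]
    have hD : Matrix.compRingEquiv (Fin m) (Basis n) ℂ (Matrix.diagonal fun _ => (K i)ᴴ)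
        = (Matrix.compRingEquiv (Fin m) (Basis n) ℂ (Matrix.diagonal fun _ => K i))ᴴ := by
      have h1 : (Matrix.diagonal fun _ : Fin m => (K i)ᴴ)
          = (Matrix.diagonal fun _ : Fin m => K i)ᴴ := by
        rw [Matrix.diagonal_conjTranspose]; rfl
      rw [h1]; rfl
    rw [hD]
    exact hA.mul_mul_conjTranspose_same _

lemma IsQuantumChannel.posSemidef {n : ℕ} {R : Op n →ₗ[ℂ] Op n} (hR : IsQuantumChannel R)
    {ρ : Op n} (hρ : ρ.PosSemidef) : (R ρ).PosSemidef :=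
  (hR.completely_positive 1 (Matrix.of fun _ _ => ρ) (hρ.submatrix Prod.snd)).submatrix
    fun b => ((0 : Fin 1), b)

lemma trace_pureState {n : ℕ} {ψ : Qubits n} (hψ : ‖ψ‖ = 1) : (pureState ψ).trace = 1 := by
  rw [pureState, Matrix.trace_vecMulVec]
  have := EuclideanSpace.inner_eq_star_dotProduct ψ ψ
  rw [← this, inner_self_eq_norm_sq_to_K, hψ]; simp

lemma star_dotProduct_self {n : ℕ} {ψ : Qubits n} (hψ : ‖ψ‖ = 1) :
    star ψ.ofLp ⬝ᵥ ψ.ofLp = 1 := by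
  rw [dotProduct_comm, ← trace_pureState hψ, pureState, Matrix.trace_vecMulVec]

lemma expval_eq_trace {n : ℕ} (A : Op n) (ψ : Qubits n) :
    expval A ψ = (A * pureState ψ).trace := by
  rw [expval, pureState, Matrix.mul_vecMulVec, Matrix.trace_vecMulVec, dotProduct_comm]

lemma pureState_mul_self {n : ℕ} {ψ : Qubits n} (hψ : ‖ψ‖ = 1) :
    pureState ψ * pureState ψ = pureState ψ := by
  rw [pureState, Matrix.vecMulVec_mul_vecMulVec, star_dotProduct_self hψ]; simp

lemma pureState_posSemidef {n : ℕ} (ψ : Qubits n) : (pureState ψ).PosSemidef :=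
  Matrix.posSemidef_vecMulVec_self_star _

lemma expval_re_nonneg {n : ℕ} {A : Op n} (hA : A.PosSemidef) (ψ : Qubits n) :
    0 ≤ (expval A ψ).re := hA.re_dotProduct_nonneg _

lemma expval_re_le_trace {n : ℕ} {A : Op n} (hA : A.PosSemidef) {ψ : Qubits n} (hψ : ‖ψ‖ = 1) :
    (expval A ψ).re ≤ A.trace.re := by
  -- `Tr A - ⟨ψ|A|ψ⟩` is the trace of `A` compressed by the projector `1 - |ψ⟩⟨ψ|`
  have hP : (1 - pureState ψ)ᴴ = 1 - pureState ψ := by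
    rw [Matrix.conjTranspose_sub, Matrix.conjTranspose_one, (pureState_posSemidef ψ).isHermitian]
  have h1 := (hA.mul_mul_conjTranspose_same (1 - pureState ψ)).trace_nonneg
  have hPP : (1 - pureState ψ) * (1 - pureState ψ) = 1 - pureState ψ := by
    rw [sub_mul, one_mul, mul_sub, mul_one, pureState_mul_self hψ, sub_self, sub_zero]
  have h2 : ((1 - pureState ψ) * A * (1 - pureState ψ)ᴴ).trace = A.trace - expval A ψ := by
    rw [hP, Matrix.trace_mul_comm, ← Matrix.mul_assoc, hPP, Matrix.trace_mul_comm,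
      expval_eq_trace, mul_sub, mul_one, Matrix.trace_sub]
  rw [h2] at h1
  have h3 := (Complex.le_def.mp h1).1
  simpa using h3

lemma depolarizing_posSemidef (ω : F4) {p : ℝ} (hp0 : 0 ≤ p) (hp1 : p ≤ 1) {n : ℕ} {ρ : Op n}
    (hρ : ρ.PosSemidef) : (depolarizing ω p ρ).PosSemidef := by
  refine Matrix.posSemidef_sum _ fun x _ => ?_
  refine (hρ.mul_mul_conjTranspose_same _).smul ?_
  exact_mod_cast errorProb_nonneg hp0 hp1 x

lemma trace_depolarizing (ω : F4) (p : ℝ) {n : ℕ} (ρ : Op n) :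
    (depolarizing ω p ρ).trace = ρ.trace := by
  have h : ∀ x : Word n, (errorOp ω x * ρ * (errorOp ω x)ᴴ).trace = ρ.trace := fun x => by
    rw [Matrix.trace_mul_comm, ← Matrix.mul_assoc, errorOp_conjTranspose, errorOp_mul_self,
      Matrix.one_mul]
  simp only [depolarizing, Matrix.trace_sum, Matrix.trace_smul, h, smul_eq_mul]
  rw [← Finset.sum_mul, ← Complex.ofReal_sum, sum_errorProb, Complex.ofReal_one, one_mul]

/-- The overlaps of a pure state with the output of a channel lie between `0` and `1`, so the real
infimum and supremum defining `minFidelity` and `fidelity` are those of bounded sets. -/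
lemma minFidelity_le_one (ω : F4) {p : ℝ} (hp0 : 0 ≤ p) (hp1 : p ≤ 1) {n : ℕ}
    {Q : Submodule ℂ (Qubits n)} (hQ : Q ≠ ⊥) {R : Op n →ₗ[ℂ] Op n} (hR : IsQuantumChannel R) :
    minFidelity ω p Q R ≤ 1 := by
  have hpos : ∀ ψ : Qubits n, (R (depolarizing ω p (pureState ψ))).PosSemidef := fun ψ =>
    hR.posSemidef (depolarizing_posSemidef ω hp0 hp1 (pureState_posSemidef ψ))
  obtain ⟨φ, hφ, hφ0⟩ := Submodule.exists_mem_ne_zero_of_ne_bot hQ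
  have hφ1 : ‖(‖φ‖⁻¹ : ℂ) • φ‖ = 1 := norm_smul_inv_norm hφ0
  have hbdd : BddBelow (Set.range fun ψ : {ψ : Qubits n // ψ ∈ Q ∧ ‖ψ‖ = 1} =>
      (expval (R (depolarizing ω p (pureState ψ.1))) ψ.1).re) :=
    ⟨0, by rintro _ ⟨ψ, rfl⟩; exact expval_re_nonneg (hpos _) _⟩
  refine (ciInf_le hbdd ⟨_, Q.smul_mem _ hφ, hφ1⟩).trans ?_
  refine (expval_re_le_trace (hpos _) hφ1).trans_eq ?_
  rw [hR.trace_preserving, trace_depolarizing, trace_pureState hφ1, Complex.one_re]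

lemma minFidelity_le_fidelity (ω : F4) {p : ℝ} (hp0 : 0 ≤ p) (hp1 : p ≤ 1) {n : ℕ}
    {Q : Submodule ℂ (Qubits n)} (hQ : Q ≠ ⊥) {R : Op n →ₗ[ℂ] Op n} (hR : IsQuantumChannel R) :
    minFidelity ω p Q R ≤ fidelity ω p Q :=
  le_ciSup (f := fun R : {R : Op n →ₗ[ℂ] Op n // IsQuantumChannel R} => minFidelity ω p Q R.1)
    ⟨1, by rintro _ ⟨R, rfl⟩; exact minFidelity_le_one ω hp0 hp1 hQ R.2⟩ ⟨R, hR⟩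

lemma expval_conj_pureState {n : ℕ} (L : Op n) (ψ : Qubits n) :
    expval (L * pureState ψ * Lᴴ) ψ = (Complex.normSq (expval L ψ) : ℂ) := by
  rw [expval, pureState, Matrix.mul_vecMulVec, Matrix.vecMulVec_mul, Matrix.vecMulVec_mulVec,
    ← Matrix.star_mulVec, dotProduct_smul, Matrix.star_dotProduct, op_smul_eq_mul, mul_comm, expval,
    Complex.normSq_eq_conj_mul_self]
  rfl

/-- Keeping for each error `x ∈ T` only the Kraus operator `K (s x)` that corrects it bounds the
minimum fidelity from below by the probability of `T`. -/
lemma sum_errorProb_le_minFidelity (ω : F4) {p : ℝ} (hp0 : 0 ≤ p) (hp1 : p ≤ 1) {n : ℕ}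
    {Q : Submodule ℂ (Qubits n)} (hQ : Q ≠ ⊥) {ι : Type*} [Fintype ι] (K : ι → Op n)
    (T : Finset (Word n)) (s : Word n → ι)
    (hs : ∀ x ∈ T, ∀ ψ ∈ Q, ‖ψ‖ = 1 → Complex.normSq (expval (K (s x) * errorOp ω x) ψ) = 1) :
    ∑ x ∈ T, errorProb p x ≤ minFidelity ω p Q (krausMap K) := by
  obtain ⟨φ, hφ, hφ0⟩ := Submodule.exists_mem_ne_zero_of_ne_bot hQ
  have : Nonempty {ψ : Qubits n // ψ ∈ Q ∧ ‖ψ‖ = 1} :=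
    ⟨⟨(‖φ‖⁻¹ : ℂ) • φ, Q.smul_mem _ hφ, norm_smul_inv_norm hφ0⟩⟩
  refine le_ciInf fun ψ => ?_
  obtain ⟨ψ, hψ, hψ1⟩ := ψ
  have h : expval (krausMap K (depolarizing ω p (pureState ψ))) ψ
      = ((∑ x : Word n, errorProb p x * ∑ i, Complex.normSq (expval (K i * errorOp ω x) ψ) : ℝ)
        : ℂ) := by
    simp only [depolarizing, map_sum, map_smul, krausMap_apply]
    have h1 : ∀ (i : ι) (x : Word n), K i * (errorOp ω x * pureState ψ * (errorOp ω x)ᴴ) * (K i)ᴴ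
        = (K i * errorOp ω x) * pureState ψ * (K i * errorOp ω x)ᴴ := fun i x => by
      simp only [Matrix.conjTranspose_mul, Matrix.mul_assoc]
    simp only [h1, expval_eq_trace _ ψ, Finset.sum_mul, Matrix.smul_mul, Matrix.trace_sum,
      Matrix.trace_smul]
    push_cast
    simp only [← expval_eq_trace, expval_conj_pureState, smul_eq_mul]
  rw [h, Complex.ofReal_re]
  refine le_trans (Finset.sum_le_sum fun x hx => ?_) (Finset.sum_le_sum_of_subset_of_nonneg
    (Finset.subset_univ T) fun x _ _ => mul_nonneg (errorProb_nonneg hp0 hp1 x)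
      (Finset.sum_nonneg fun i _ => Complex.normSq_nonneg _))
  refine le_mul_of_one_le_right (errorProb_nonneg hp0 hp1 x) ?_
  rw [← hs x hx ψ hψ hψ1]
  exact Finset.single_le_sum (f := fun i => Complex.normSq (expval (K i * errorOp ω x) ψ))
    (fun i _ => Complex.normSq_nonneg _) (Finset.mem_univ (s x))

/-! ### Syndrome decoding -/

namespace Stabilizes

variable {ω : F4} {n : ℕ} {C : AddSubgroup (Word n)} {ε : Word n → ℤˣ}
  {Q : Submodule ℂ (Qubits n)}

/-- The range projector `E_x P E_x` of the code moved by `E_x` is idempotent. -/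
lemma rangeProj_mul_self (ω : F4) (Q : Submodule ℂ (Qubits n)) (x : Word n) :
    (errorOp ω x * proj Q * errorOp ω x) * (errorOp ω x * proj Q * errorOp ω x)
      = errorOp ω x * proj Q * errorOp ω x := by
  calc _ = errorOp ω x * proj Q * (errorOp ω x * errorOp ω x) * proj Q * errorOp ω x := by
        simp only [Matrix.mul_assoc]
    _ = _ := by rw [errorOp_mul_self, Matrix.mul_one, Matrix.mul_assoc (errorOp ω x),
        proj_mul_proj]

lemma rangeProj_mul (hω0 : ω ≠ 0) (hω1 : ω ≠ 1) (h : Stabilizes ω C ε Q) {x y : Word n}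
    (hxy : x + y ∉ C) :
    (errorOp ω x * proj Q * errorOp ω x) * (errorOp ω y * proj Q * errorOp ω y) = 0 := by
  obtain ⟨c, -, hc⟩ := exists_errorOp_mul hω0 hω1 x y
  calc _ = errorOp ω x * (proj Q * (errorOp ω x * errorOp ω y) * proj Q) * errorOp ω y := by
        simp only [Matrix.mul_assoc]
    _ = 0 := by
        rw [hc, Matrix.mul_smul, Matrix.smul_mul, h.proj_mul_errorOp_mul_proj hω0 hω1 hxy]
        simp

/-- The Kraus operators of syndrome decoding: for each syndrome `s` in a set of cosets of `C`
with representatives `l s`, undo the error `l s` and project onto the code; the remaining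
operator projects onto the complement of the spaces reached in this way. -/
noncomputable def decoder (ω : F4) (Q : Submodule ℂ (Qubits n)) {σ : Type*} [Fintype σ]
    (l : σ → Word n) : Option σ → Op n
  | some s => proj Q * errorOp ω (l s)
  | none => 1 - ∑ s, errorOp ω (l s) * proj Q * errorOp ω (l s)

lemma sum_decoder (hω0 : ω ≠ 0) (hω1 : ω ≠ 1) (h : Stabilizes ω C ε Q) {σ : Type*} [Fintype σ]
    {l : σ → Word n} (hl : ∀ s t, s ≠ t → l s + l t ∉ C) :
    ∑ i, (decoder ω Q l i)ᴴ * decoder ω Q l i = 1 := by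
  classical
  set S := ∑ s, errorOp ω (l s) * proj Q * errorOp ω (l s) with hS
  have hSS : S * S = S := by
    rw [hS, Finset.sum_mul_sum]
    refine Finset.sum_congr rfl fun s _ => ?_
    rw [Finset.sum_eq_single s (fun t _ hts => h.rangeProj_mul hω0 hω1 (hl s t hts.symm))
      (by simp), rangeProj_mul_self]
  have hSH : Sᴴ = S := by
    simp only [hS, Matrix.conjTranspose_sum, Matrix.conjTranspose_mul, errorOp_conjTranspose,
      proj_conjTranspose, Matrix.mul_assoc]
  have h1 : ∀ s, (decoder ω Q l (some s))ᴴ * decoder ω Q l (some s)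
      = errorOp ω (l s) * proj Q * errorOp ω (l s) := fun s => by
    rw [decoder, Matrix.conjTranspose_mul, errorOp_conjTranspose, proj_conjTranspose,
      ← Matrix.mul_assoc, Matrix.mul_assoc (errorOp ω (l s)), proj_mul_proj]
  rw [Fintype.sum_option, Finset.sum_congr rfl fun s _ => h1 s, ← hS]
  rw [decoder, ← hS, Matrix.conjTranspose_sub, hSH, Matrix.conjTranspose_one, sub_mul,
    one_mul, mul_sub, mul_one, hSS, sub_self, sub_zero, sub_add_cancel]

/-- The errors that some logical operator moves to an error of at most the same weight; all
others are corrected when the lightest error of each syndrome is undone. -/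
noncomputable def confusable (C : AddSubgroup (Word n)) : Finset (Word n) :=
  by classical exact Finset.univ.filter fun x =>
    ∃ e ∈ logicals C, hammingNorm (x + e) ≤ hammingNorm x

/-- Each coset of `C` has an element of least weight. -/
lemma exists_leaders (C : AddSubgroup (Word n)) :
    ∃ l : Word n ⧸ C → Word n, (∀ s, (l s : Word n ⧸ C) = s) ∧
      ∀ x : Word n, hammingNorm (l x) ≤ hammingNorm x := by
  have h : ∀ s : Word n ⧸ C, ∃ y : Word n, (y : Word n ⧸ C) = s ∧
      ∀ x : Word n, (x : Word n ⧸ C) = s → hammingNorm y ≤ hammingNorm x := fun s => by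
    obtain ⟨y, hy, hmin⟩ := (Set.toFinite {y : Word n | (y : Word n ⧸ C) = s}).exists_minimalFor
      hammingNorm _ (QuotientAddGroup.mk_surjective s)
    exact ⟨y, hy, fun x hx => (le_total _ _).elim id fun hle => hmin hx hle⟩
  choose l hl hmin using h
  exact ⟨l, hl, fun x => hmin _ x rfl⟩

lemma mk_eq_iff_add_mem {x y : Word n} : (x : Word n ⧸ C) = y ↔ x + y ∈ C := by
  have : -x = x := (eq_neg_of_add_eq_zero_left (word_add_self x)).symm
  rw [QuotientAddGroup.eq, this]

lemma one_sub_fidelity_le (hω0 : ω ≠ 0) (hω1 : ω ≠ 1) (h : Stabilizes ω C ε Q) {p : ℝ}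
    (hp0 : 0 ≤ p) (hp1 : p ≤ 1) (hQ : Q ≠ ⊥) :
    1 - fidelity ω p Q ≤ ∑ x ∈ confusable C, errorProb p x := by
  classical
  obtain ⟨l, hl, hmin⟩ := exists_leaders C
  have : Fintype (Word n ⧸ C) := Fintype.ofFinite _
  have hsep : ∀ s t, s ≠ t → l s + l t ∉ C := fun s t hst hmem =>
    hst (by rw [← hl s, ← hl t]; exact mk_eq_iff_add_mem.mpr hmem)
  have hR := isQuantumChannel_krausMap (h.sum_decoder hω0 hω1 hsep)
  have h1 := minFidelity_le_fidelity ω hp0 hp1 hQ hR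
  have h2 := sum_errorProb_le_minFidelity ω hp0 hp1 hQ (decoder ω Q l) (confusable C)ᶜ
    (fun x => some (x : Word n ⧸ C)) ?_
  · have h3 := Finset.sum_compl_add_sum (confusable C) fun x => errorProb p x
    rw [sum_errorProb] at h3
    linarith
  -- outside `confusable C`, the error and its leader differ by an element of the stabilizer
  intro x hx ψ hψ hψ1
  have hlC : l x + x ∈ C := mk_eq_iff_add_mem.mp (hl x)
  have hdual : l x + x ∈ hermDual C := by
    by_contra hnd
    refine Finset.mem_compl.mp hx (Finset.mem_filter.mpr ⟨Finset.mem_univ _, l x + x,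
      mem_logicals.mpr ⟨hlC, hnd⟩, ?_⟩)
    rw [add_comm (l x), ← add_assoc, word_add_self, zero_add]
    exact hmin x
  obtain ⟨c, hc1, hc⟩ := exists_errorOp_mul hω0 hω1 (l x) x
  rw [decoder, Matrix.mul_assoc, hc, expval, ← Matrix.mulVec_mulVec, Matrix.smul_mulVec,
    h.errorOp_mulVec hdual hψ, Matrix.mulVec_smul, Matrix.mulVec_smul, proj_mulVec_of_mem hψ,
    smul_smul, dotProduct_smul, star_dotProduct_self hψ1, smul_eq_mul, mul_one,
    Complex.normSq_eq_norm_sq, norm_mul, hc1]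
  rcases Int.units_eq_one_or (ε (l x + x)) with hu | hu <;> simp [hu]

end Stabilizes

/-! ### The bound for one code and for an ensemble -/

namespace Stabilizes

variable {ω : F4} {n : ℕ} {C : AddSubgroup (Word n)} {ε : Word n → ℤˣ}
  {Q : Submodule ℂ (Qubits n)}

lemma mem_confusable {x : Word n} : x ∈ confusable C ↔
    ∃ e ∈ logicals C, hammingNorm (x + e) ≤ hammingNorm x := by
  simp [confusable]

/-- A logical operator confusing an error of weight `m` has weight at most `2m`. -/
lemma hammingNorm_le_of_confusable {x e : Word n} (h : hammingNorm (x + e) ≤ hammingNorm x) :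
    hammingNorm e ≤ 2 * hammingNorm x := by
  have h1 := hammingDist_triangle x 0 (x + e)
  have h2 : hammingDist x (x + e) = hammingNorm e := by
    rw [hammingDist_eq_hammingNorm, neg_add_cancel_left]
  rw [hammingDist_zero_right, hammingDist_zero_left, h2] at h1
  lia

lemma hammingNorm_le (x : Word n) : hammingNorm x ≤ n := by
  simpa using hammingNorm_le_card_fintype (x := x)

lemma card_confusable_weight_le (hω0 : ω ≠ 0) (hω1 : ω ≠ 1) (h : Stabilizes ω C ε Q)
    (hQ : Module.finrank ℂ Q ≠ 0) {d : ℕ} (hd : d ≤ minDist ω Q) (m : ℕ) :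
    (((confusable C).filter fun x => hammingNorm x = m).card : ℝ) ≤
      ∑ w ∈ Finset.Icc d (min (2 * m) n), (enumB ω Q w - enumBperp ω Q w) * (G n m w : ℝ) := by
  classical
  set L := (logicals C).filter fun e => hammingNorm e ∈ Finset.Icc d (min (2 * m) n) with hL
  have hsub : ((confusable C).filter fun x => hammingNorm x = m) ⊆ L.biUnion fun e =>
      Finset.univ.filter fun x : Word n => hammingNorm x = m ∧ hammingNorm (x + e) ≤ m := by
    intro x hx
    obtain ⟨hxC, rfl⟩ := Finset.mem_filter.mp hx
    obtain ⟨e, he, hxe⟩ := mem_confusable.mp hxC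
    have h1 := hammingNorm_le_of_confusable hxe
    have h2 := hd.trans (h.minDist_le hω0 hω1 hQ he)
    have h3 := hammingNorm_le e
    simp only [Finset.mem_biUnion, hL, Finset.mem_filter, Finset.mem_Icc, Finset.mem_univ]
    exact ⟨e, ⟨he, h2, le_min h1 h3⟩, trivial, trivial, hxe⟩
  have hcard : ((confusable C).filter fun x => hammingNorm x = m).card
      ≤ ∑ e ∈ L, G n m (hammingNorm e) :=
    (Finset.card_le_card hsub).trans
      (Finset.card_biUnion_le.trans (Finset.sum_le_sum fun e _ => card_confusable_le e m))
  have hfib : ∑ e ∈ L, G n m (hammingNorm e) = ∑ w ∈ Finset.Icc d (min (2 * m) n),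
      ((logicals C).filter fun e => hammingNorm e = w).card * G n m w := by
    rw [← Finset.sum_fiberwise_of_maps_to (s := L) (g := hammingNorm)
      fun e he => (Finset.mem_filter.mp he).2]
    refine Finset.sum_congr rfl fun w hw => ?_
    rw [Finset.sum_congr rfl fun e he => by rw [(Finset.mem_filter.mp he).2], Finset.sum_const,
      smul_eq_mul]
    congr 2
    ext e
    simp only [hL, Finset.mem_filter]
    grind
  rw [hfib] at hcard
  refine (Nat.cast_le.mpr hcard).trans_eq ?_
  rw [Nat.cast_sum]
  refine Finset.sum_congr rfl fun w _ => ?_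
  rw [h.enumB_sub_enumBperp hω0 hω1 hQ, Nat.cast_mul]

lemma one_sub_fidelity_le_sum_min (hω0 : ω ≠ 0) (hω1 : ω ≠ 1) (h : Stabilizes ω C ε Q)
    (hQ : Module.finrank ℂ Q ≠ 0) {p : ℝ} (hp0 : 0 ≤ p) (hp1 : p ≤ 1) {d : ℕ}
    (hd : d ≤ minDist ω Q) :
    1 - fidelity ω p Q ≤ ∑ m ∈ Finset.Icc ((d + 1) / 2) n, (p / 3) ^ m * (1 - p) ^ (n - m) *
      min ((n.choose m : ℝ) * 3 ^ m)
        (∑ w ∈ Finset.Icc d (min (2 * m) n),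
          (enumB ω Q w - enumBperp ω Q w) * (G n m w : ℝ)) := by
  classical
  have hbot : Q ≠ ⊥ := fun h0 => hQ (by rw [h0, finrank_bot])
  have hmaps : ∀ x ∈ confusable C, hammingNorm x ∈ Finset.Icc ((d + 1) / 2) n := by
    intro x hx
    obtain ⟨e, he, hxe⟩ := mem_confusable.mp hx
    have h1 := hammingNorm_le_of_confusable hxe
    have h2 := hd.trans (h.minDist_le hω0 hω1 hQ he)
    exact Finset.mem_Icc.mpr ⟨by lia, hammingNorm_le x⟩
  refine (h.one_sub_fidelity_le hω0 hω1 hp0 hp1 hbot).trans ?_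
  rw [← Finset.sum_fiberwise_of_maps_to hmaps]
  refine Finset.sum_le_sum fun m _ => ?_
  have hq : 0 ≤ 1 - p := by linarith
  rw [Finset.sum_congr rfl fun x hx => by rw [errorProb, (Finset.mem_filter.mp hx).2],
    Finset.sum_const, nsmul_eq_mul, mul_comm]
  refine mul_le_mul_of_nonneg_left (le_min ?_ ?_) (by positivity)
  · refine le_trans (Nat.cast_le.mpr (Finset.card_le_card (Finset.filter_subset_filter _
      (Finset.subset_univ _)))) ?_
    exact_mod_cast card_hammingNorm_eq_le n m
  · exact h.card_confusable_weight_le hω0 hω1 hQ hd m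

end Stabilizes

lemma average_mono {α : Type*} {S : Finset α} {f g : α → ℝ} (h : ∀ a ∈ S, f a ≤ g a) :
    average S f ≤ average S g :=
  mul_le_mul_of_nonneg_left (Finset.sum_le_sum h) (by positivity)

lemma average_const {α : Type*} {S : Finset α} (hS : S.Nonempty) (c : ℝ) :
    average S (fun _ => c) = c := by
  have : (S.card : ℝ) ≠ 0 := Nat.cast_ne_zero.mpr hS.card_pos.ne'
  rw [average, Finset.sum_const, nsmul_eq_mul]
  field_simp

lemma average_sub {α : Type*} (S : Finset α) (f g : α → ℝ) :
    average S (fun a => f a - g a) = average S f - average S g := by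
  simp only [average, Finset.sum_sub_distrib, mul_sub]

lemma average_mul {α : Type*} (S : Finset α) (f : α → ℝ) (c : ℝ) :
    average S (fun a => f a * c) = average S f * c := by
  simp only [average, ← Finset.sum_mul, mul_assoc]

lemma average_sum {α ι : Type*} (S : Finset α) (t : Finset ι) (f : ι → α → ℝ) :
    average S (fun a => ∑ i ∈ t, f i a) = ∑ i ∈ t, average S (f i) := by
  simp only [average, Finset.mul_sum]
  exact Finset.sum_comm

lemma average_min_le {α : Type*} {S : Finset α} (hS : S.Nonempty) (c : ℝ) (f : α → ℝ) :
    average S (fun a => min c (f a)) ≤ min c (average S f) :=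
  le_min ((average_mono fun _ _ => min_le_left _ _).trans_eq (average_const hS c))
    (average_mono fun _ _ => min_le_right _ _)

end StabFidelity

theorem mainTheorem2 (ω : F4) (hω0 : ω ≠ 0) (hω1 : ω ≠ 1) (n k : ℕ)
    (p : ℝ) (hp0 : 0 ≤ p) (hp1 : p ≤ 1)
    (S : Finset (Submodule ℂ (Qubits n))) (hS : S.Nonempty)
    (hstab : ∀ Q ∈ S, IsStabilizerCode ω n k Q)
    (dmin : ℕ) (hdmin : dmin = S.inf' hS (fun Q => minDist ω Q)) :
    1 - average S (fun Q => fidelity ω p Q) = average S (fun Q => 1 - fidelity ω p Q) ∧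
    average S (fun Q => 1 - fidelity ω p Q) ≤
      ∑ m ∈ Finset.Icc ((dmin + 1) / 2) n,
        (p / 3) ^ m * (1 - p) ^ (n - m) *
          min ((n.choose m : ℝ) * 3 ^ m) (avgN ω S dmin m) := by
  refine ⟨by rw [average_sub, average_const hS], ?_⟩
  have hq : 0 ≤ 1 - p := by linarith
  refine (average_mono (g := fun Q => ∑ m ∈ Finset.Icc ((dmin + 1) / 2) n,
    min ((n.choose m : ℝ) * 3 ^ m) (∑ w ∈ Finset.Icc dmin (min (2 * m) n),
      (enumB ω Q w - enumBperp ω Q w) * (G n m w : ℝ)) *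
        ((p / 3) ^ m * (1 - p) ^ (n - m))) fun Q hQ => ?_).trans ?_
  · obtain ⟨C, ε, -, hdual, hmem, hdim⟩ := hstab Q hQ
    have h : Stabilizes ω C ε Q := ⟨hdual, hmem⟩
    have hd : dmin ≤ minDist ω Q := hdmin.trans_le (Finset.inf'_le _ hQ)
    have hne : Module.finrank ℂ Q ≠ 0 := by rw [hdim]; positivity
    refine (h.one_sub_fidelity_le_sum_min hω0 hω1 hne hp0 hp1 hd).trans_eq ?_
    exact Finset.sum_congr rfl fun m _ => mul_comm _ _
  · rw [average_sum]
    refine Finset.sum_le_sum fun m _ => ?_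
    rw [average_mul, mul_comm]
    refine mul_le_mul_of_nonneg_left ((average_min_le hS _ _).trans_eq ?_) (by positivity)
    rw [average_sum, avgN]
    simp only [average_mul, average_sub]
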